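/- Let $\Omega\subset\mathbb R^d$, $d\in\{2,3\}$, be a bounded polygonal (polyhedral) domain with $\partial\Omega=\Gamma_d\cup\Gamma_t=\Gamma_p\cup\Gamma_f$, where $\Gamma_d$ and $\Gamma_p$ have positive surface measure. Let $\mu,\lambda,\alpha>0$, let the storage coefficient be $c_0\ge 0$, let $K$ be a measurable scalar function with $0<k_0\le K\le k_1$ on $\Omega$ for some constants $k_0,k_1$ (for instance a positive constant), and let $\boldsymbol f\in \boldsymbol L^2(\Omega)$, $\boldsymbol h\in\boldsymbol L^2(\Gamma_t)$, $Q_s\in L^2(\Omega)$, $g_2\in L^2(\Gamma_f)$ be independent of time. Let $T_h$ be a finite conforming simplicial mesh of $\overline\Omega$, and let $\boldsymbol V_h$ be the continuous piecewise $\boldsymbol P_2$ vector fields vanishing on $\Gamma_d$, $W_h$ the continuous piecewise $P_1$ functions, and $M_h$ the continuous piecewise $P_1$ functions vanishing on $\Gamma_p$. Write $(\cdot,\cdot)$ for the $L^2(\Omega)$ inner products, $\langle\cdot,\cdot\rangle_\Gamma$ for the $L^2(\Gamma)$ inner products, and $\varepsilon(\boldsymbol u)=\frac12(\nabla \boldsymbol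 u+(\nabla\boldsymbol u)^T)$. Let $T>0$, $N\ge1$ and $\Delta t=T/N$. *Coupled algorithm.* Let $(\boldsymbol u_h^n,\xi_h^n,p_h^n)\in \boldsymbol V_h\times W_h\times M_h$, $0\le n\le N$, satisfy, for $1\le n\le N$ and all $(\boldsymbol v_h,\phi_h,\psi_h)\in \boldsymbol V_h\times W_h\times M_h$, $$2\mu(\varepsilon(\boldsymbol u_h^n),\varepsilon(\boldsymbol v_h))-(\xi_h^n,\operatorname{div}\boldsymbol v_h)=(\boldsymbol f,\boldsymbol v_h)+\langle \boldsymbol h,\boldsymbol v_h\rangle_{\Gamma_t},$$ $$(\operatorname{div}\boldsymbol u_h^n,\phi_h)+\tfrac1\lambda(\xi_h^n,\phi_h)-\tfrac\alpha\lambda(p_h^n,\phi_h)=0,$$ $$(c_0+\tfrac{\alpha^2}\lambda)(p_h^n,\psi_h)-\tfrac\alpha\lambda(\xi_h^n,\psi_h)+\Delta t(K\nabla p_h^n,\nabla\psi_h)=\Delta t(Q_s,\psi_h)+\Delta t\langle g_2,\psi_h\rangle_{\Gamma_f}+(c_0+\tfrac{\alpha^2}\lambda)(p_h^{n-1},\psi_h)-\tfrac\alpha\lambda(\xi_h^{n-1},\psi_h).$$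 *Iterative decoupled algorithm.* Fix $1\le n\le N$, put $(\boldsymbol u_h^{n,0},\xi_h^{n,0},p_h^{n,0})=(\boldsymbol u_h^{n-1},\xi_h^{n-1},p_h^{n-1})$, and for $i\ge1$ let $p_h^{n,i}\in M_h$ and then $(\boldsymbol u_h^{n,i},\xi_h^{n,i})\in\boldsymbol V_h\times W_h$ satisfy, for all $(\boldsymbol v_h,\phi_h,\psi_h)\in \boldsymbol V_h\times W_h\times M_h$, $$(c_0+\tfrac{\alpha^2}\lambda)(p_h^{n,i},\psi_h)+\Delta t(K\nabla p_h^{n,i},\nabla\psi_h)=(c_0+\tfrac{\alpha^2}\lambda)(p_h^{n-1},\psi_h)+\tfrac\alpha\lambda(\xi_h^{n,i-1}-\xi_h^{n-1},\psi_h)+\Delta t(Q_s,\psi_h)+\Delta t\langle g_2,\psi_h\rangle_{\Gamma_f},$$ $$2\mu(\varepsilon(\boldsymbol u_h^{n,i}),\varepsilon(\boldsymbol v_h))-(\xi_h^{n,i},\operatorname{div}\boldsymbol v_h)=(\boldsymbol f,\boldsymbol v_h)+\langle\boldsymbol h,\boldsymbol v_h\rangle_{\Gamma_t},\qquad (\operatorname{div}\boldsymbol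 u_h^{n,i},\phi_h)+\tfrac1\lambda(\xi_h^{n,i},\phi_h)=\tfrac\alpha\lambda(p_h^{n,i},\phi_h).$$ Let $e_{\boldsymbol u}^i=\boldsymbol u_h^{n,i}-\boldsymbol u_h^n$, $e_\xi^i=\xi_h^{n,i}-\xi_h^n$, $e_p^i=p_h^{n,i}-p_h^n$, and $C=\left(\frac{\alpha^2/\lambda}{c_0+\alpha^2/\lambda}\right)^2$. If $c_0=0$, then $C=1$ and $\|e_\xi^i\|_{L^2(\Omega)}\le C\|e_\xi^{i-1}\|_{L^2(\Omega)}$ for all $i\ge1$; and nevertheless the iteration converges: $$\lim_{i\to\infty}\|e_\xi^i\|_{L^2(\Omega)}=0,\qquad \lim_{i\to\infty}\|\varepsilon(e_{\boldsymbol u}^i)\|_{L^2(\Omega)}=0,\qquad \lim_{i\to\infty}\|e_p^i\|_{L^2(\Omega)}=0.$$ -/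

import Mathlib

open MeasureTheory

noncomputable section

namespace Biot

/-- Euclidean space `ℝ^d`. -/
abbrev E (d : ℕ) : Type := EuclideanSpace ℝ (Fin d)

/-! ### Domain and mesh -/

/-- A bounded polygonal (polyhedral) domain of `ℝ^d`: nonempty, open, connected, bounded, and its
boundary is contained in a finite union of proper affine subspaces (hyperplanes). -/
def IsPolygonalDomain {d : ℕ} (Ω : Set (E d)) : Prop :=
  IsOpen Ω ∧ IsConnected Ω ∧ Bornology.IsBounded Ω ∧
    ∃ A : Set (AffineSubspace ℝ (E d)), A.Finite ∧ (∀ H ∈ A, H ≠ ⊤) ∧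
      frontier Ω ⊆ ⋃ H ∈ A, (H : Set (E d))

/-- The (closed, nondegenerate) `d`-simplices of a simplicial complex in `ℝ^d`: the elements of
the mesh. -/
def cells {d : ℕ} (T : Geometry.SimplicialComplex ℝ (E d)) : Set (Set (E d)) :=
  {K | ∃ s ∈ T.faces, s.card = d + 1 ∧ K = convexHull ℝ (s : Set (E d))}

/-- `T` is a conforming simplicial mesh (triangulation) of `Ω`: a finite simplicial complex with
underlying space the closure of `Ω`, each simplex of which is a face of a `d`-simplex. -/
structure IsMesh {d : ℕ} (Ω : Set (E d)) (T : Geometry.SimplicialComplex ℝ (E d)) : Prop where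
  finite : T.faces.Finite
  space_eq : T.space = closure Ω
  pure : ∀ s ∈ T.faces, ∃ t ∈ T.faces, s ⊆ t ∧ t.card = d + 1

/-! ### Finite element spaces

Finite element functions are represented by functions on the whole of `ℝ^d`; their values
outside the closure of `Ω` play no role. -/

/-- The restriction of `v` to `K` belongs to `P_k(K)`: it is a polynomial of total degree at
most `k`. -/
def IsPolyOn {d : ℕ} (k : ℕ) (K : Set (E d)) (v : E d → ℝ) : Prop :=
  ∃ q : MvPolynomial (Fin d) ℝ, q.totalDegree ≤ k ∧
    ∀ x ∈ K, v x = MvPolynomial.eval (fun j => x j) q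

/-- Continuous `P_k` Lagrange finite element functions on the mesh `T` of `Ω`. -/
def lagrange {d : ℕ} (k : ℕ) (Ω : Set (E d)) (T : Geometry.SimplicialComplex ℝ (E d)) :
    Set (E d → ℝ) :=
  {v | ContinuousOn v (closure Ω) ∧ ∀ K ∈ cells T, IsPolyOn k K v}

/-- The displacement space `V_h`: continuous piecewise `P_2` vector fields that vanish
on `Γd`. -/
def Vh {d : ℕ} (Ω Γd : Set (E d)) (T : Geometry.SimplicialComplex ℝ (E d)) :
    Set (E d → E d) :=
  {v | (∀ i : Fin d, (fun x => v x i) ∈ lagrange 2 Ω T) ∧ ∀ x ∈ Γd, v x = 0}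

/-- The total pressure space `W_h`: continuous piecewise `P_1` functions. -/
def Wh {d : ℕ} (Ω : Set (E d)) (T : Geometry.SimplicialComplex ℝ (E d)) : Set (E d → ℝ) :=
  lagrange 1 Ω T

/-- The fluid pressure space `M_h`: continuous piecewise `P_1` functions that vanish
on `Γp`. -/
def Mh {d : ℕ} (Ω Γp : Set (E d)) (T : Geometry.SimplicialComplex ℝ (E d)) : Set (E d → ℝ) :=
  {ψ | ψ ∈ lagrange 1 Ω T ∧ ∀ x ∈ Γp, ψ x = 0}

/-! ### Differential operators, inner products and norms

Finite element functions are polynomials in the interior of each cell, so that their weak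
derivatives are the classical derivatives, which exist off a null set (the union of the cell
boundaries). All these functions and derivatives are bounded on `Ω`, so that the integrals
below exist. -/

/-- The partial derivative `∂_j u_i`. -/
def pderiv {d : ℕ} (u : E d → E d) (i j : Fin d) (x : E d) : ℝ :=
  (fderiv ℝ u x (EuclideanSpace.single j 1)) i

/-- The divergence of a vector field. -/
def divg {d : ℕ} (u : E d → E d) (x : E d) : ℝ :=
  ∑ i, pderiv u i i x

/-- The strain tensor `ε(u) = (∇u + (∇u)ᵀ) / 2`. -/
def strain {d : ℕ} (u : E d → E d) (x : E d) : Matrix (Fin d) (Fin d) ℝ :=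
  Matrix.of fun i j => (pderiv u i j x + pderiv u j i x) / 2

/-- The `L²(Ω)` inner product of scalar functions. -/
def innerS {d : ℕ} (Ω : Set (E d)) (p q : E d → ℝ) : ℝ :=
  ∫ x in Ω, p x * q x

/-- The `L²(Ω)` inner product of vector fields. -/
def innerV {d : ℕ} (Ω : Set (E d)) (u v : E d → E d) : ℝ :=
  ∫ x in Ω, inner ℝ (u x) (v x)

/-- The `L²(Ω)` inner product of matrix fields. -/
def innerM {d : ℕ} (Ω : Set (E d)) (A B : E d → Matrix (Fin d) (Fin d) ℝ) : ℝ :=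
  ∫ x in Ω, ∑ i, ∑ j, A x i j * B x i j

/-- The `L²(Ω)` norm of a scalar function. -/
def normS {d : ℕ} (Ω : Set (E d)) (p : E d → ℝ) : ℝ :=
  Real.sqrt (innerS Ω p p)

/-- The `L²(Ω)` norm of a matrix field. -/
def normM {d : ℕ} (Ω : Set (E d)) (A : E d → Matrix (Fin d) (Fin d) ℝ) : ℝ :=
  Real.sqrt (innerM Ω A A)

/-! ### The Biot problem -/

/-- The data of the (quasi-static) Biot problem: domain, boundary parts, physical parameters,
body force `f`, boundary traction `h`, source `Qs` and boundary flux `g2`. -/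
structure Data (d : ℕ) where
  Ω : Set (E d)
  Γd : Set (E d)
  Γt : Set (E d)
  Γp : Set (E d)
  Γf : Set (E d)
  mu : ℝ
  lam : ℝ
  α : ℝ
  c₀ : ℝ
  kappa : E d → ℝ
  f : E d → E d
  h : E d → E d
  Qs : E d → ℝ
  g2 : E d → ℝ

/-- The `(d - 1)`-dimensional surface measure of `ℝ^d`. -/
def surf (d : ℕ) : Measure (E d) := Measure.euclideanHausdorffMeasure (d - 1)

/-- The standing assumptions on the data. -/
structure Data.Admissible {d : ℕ} (B : Data d) : Prop where
  domain : IsPolygonalDomain B.Ω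
  meas_d : MeasurableSet B.Γd
  meas_t : MeasurableSet B.Γt
  meas_p : MeasurableSet B.Γp
  meas_f : MeasurableSet B.Γf
  union_dt : B.Γd ∪ B.Γt = frontier B.Ω
  union_pf : B.Γp ∪ B.Γf = frontier B.Ω
  pos_d : 0 < surf d B.Γd
  pos_p : 0 < surf d B.Γp
  mu_pos : 0 < B.mu
  lam_pos : 0 < B.lam
  α_pos : 0 < B.α
  c₀_nonneg : 0 ≤ B.c₀
  kappa_meas : Measurable B.kappa
  kappa_bdd : ∃ k₀ k₁ : ℝ, 0 < k₀ ∧ ∀ x ∈ B.Ω, k₀ ≤ B.kappa x ∧ B.kappa x ≤ k₁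
  f_mem : MemLp B.f 2 (volume.restrict B.Ω)
  h_mem : MemLp B.h 2 ((surf d).restrict B.Γt)
  Qs_mem : MemLp B.Qs 2 (volume.restrict B.Ω)
  g2_mem : MemLp B.g2 2 ((surf d).restrict B.Γf)

/-- The form `(K ∇p, ∇ψ)`. -/
def Data.diffusion {d : ℕ} (B : Data d) (p ψ : E d → ℝ) : ℝ :=
  ∫ x in B.Ω, B.kappa x * inner ℝ (gradient p x) (gradient ψ x)

/-- The load `(f, v) + ⟨h, v⟩_{Γt}`. -/
def Data.loadV {d : ℕ} (B : Data d) (v : E d → E d) : ℝ :=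
  innerV B.Ω B.f v + ∫ x in B.Γt, inner ℝ (B.h x) (v x) ∂(surf d)

/-- The load `(Qs, ψ) + ⟨g2, ψ⟩_{Γf}`. -/
def Data.loadM {d : ℕ} (B : Data d) (ψ : E d → ℝ) : ℝ :=
  innerS B.Ω B.Qs ψ + ∫ x in B.Γf, B.g2 x * ψ x ∂(surf d)

/-- The discrete momentum equation
`2μ (ε(u), ε(v)) - (ξ, div v) = (f, v) + ⟨h, v⟩_{Γt}` for all `v ∈ V_h`. -/
def Data.Momentum {d : ℕ} (B : Data d) (T : Geometry.SimplicialComplex ℝ (E d))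
    (u : E d → E d) (ξ : E d → ℝ) : Prop :=
  ∀ v ∈ Vh B.Ω B.Γd T,
    2 * B.mu * innerM B.Ω (strain u) (strain v) - innerS B.Ω ξ (divg v) = B.loadV v

/-- The discrete total pressure equation
`(div u, φ) + (1/λ) (ξ, φ) = (α/λ) (p, φ)` for all `φ ∈ W_h`. -/
def Data.TotalPressure {d : ℕ} (B : Data d) (T : Geometry.SimplicialComplex ℝ (E d))
    (u : E d → E d) (ξ p : E d → ℝ) : Prop :=
  ∀ φ ∈ Wh B.Ω T,
    innerS B.Ω (divg u) φ + 1 / B.lam * innerS B.Ω ξ φ = B.α / B.lam * innerS B.Ω p φ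

/-- The coupled algorithm with time step `Δt` on the time levels `0, …, N`: `(u n, ξ n, p n)` is
the fully discrete solution at time level `n`, obtained by the backward Euler scheme from initial
values in the finite element spaces. -/
structure Data.IsCoupled {d : ℕ} (B : Data d) (T : Geometry.SimplicialComplex ℝ (E d))
    (Δt : ℝ) (N : ℕ) (u : ℕ → E d → E d) (ξ p : ℕ → E d → ℝ) : Prop where
  u_mem : ∀ n ≤ N, u n ∈ Vh B.Ω B.Γd T
  ξ_mem : ∀ n ≤ N, ξ n ∈ Wh B.Ω T
  p_mem : ∀ n ≤ N, p n ∈ Mh B.Ω B.Γp T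
  momentum : ∀ n, 1 ≤ n → n ≤ N → B.Momentum T (u n) (ξ n)
  totalPressure : ∀ n, 1 ≤ n → n ≤ N → B.TotalPressure T (u n) (ξ n) (p n)
  pressure : ∀ n, 1 ≤ n → n ≤ N → ∀ ψ ∈ Mh B.Ω B.Γp T,
    (B.c₀ + B.α ^ 2 / B.lam) * innerS B.Ω (p n) ψ - B.α / B.lam * innerS B.Ω (ξ n) ψ
        + Δt * B.diffusion (p n) ψ
      = Δt * B.loadM ψ + (B.c₀ + B.α ^ 2 / B.lam) * innerS B.Ω (p (n - 1)) ψ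
        - B.α / B.lam * innerS B.Ω (ξ (n - 1)) ψ

/-- The iterative decoupled algorithm within one time step of size `Δt`, started from the values
`(u₀, ξ₀, p₀)` of the previous time level: `(u i, ξ i, p i)` is the `i`-th iterate. In iteration
`i ≥ 1` first `p i` is computed from `ξ (i - 1)`, then `(u i, ξ i)` is computed from `p i`. -/
structure Data.IsIterative {d : ℕ} (B : Data d) (T : Geometry.SimplicialComplex ℝ (E d))
    (Δt : ℝ) (u₀ : E d → E d) (ξ₀ p₀ : E d → ℝ)
    (u : ℕ → E d → E d) (ξ p : ℕ → E d → ℝ) : Prop where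
  u_init : u 0 = u₀
  ξ_init : ξ 0 = ξ₀
  p_init : p 0 = p₀
  u_mem : ∀ i, 1 ≤ i → u i ∈ Vh B.Ω B.Γd T
  ξ_mem : ∀ i, 1 ≤ i → ξ i ∈ Wh B.Ω T
  p_mem : ∀ i, 1 ≤ i → p i ∈ Mh B.Ω B.Γp T
  pressure : ∀ i, 1 ≤ i → ∀ ψ ∈ Mh B.Ω B.Γp T,
    (B.c₀ + B.α ^ 2 / B.lam) * innerS B.Ω (p i) ψ + Δt * B.diffusion (p i) ψ
      = (B.c₀ + B.α ^ 2 / B.lam) * innerS B.Ω p₀ ψ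
        + B.α / B.lam * innerS B.Ω (ξ (i - 1) - ξ₀) ψ + Δt * B.loadM ψ
  momentum : ∀ i, 1 ≤ i → B.Momentum T (u i) (ξ i)
  totalPressure : ∀ i, 1 ≤ i → B.TotalPressure T (u i) (ξ i) (p i)

/-- The contraction constant `((α²/λ) / (c₀ + α²/λ))²`. -/
def Data.contractionConst {d : ℕ} (B : Data d) : ℝ :=
  ((B.α ^ 2 / B.lam) / (B.c₀ + B.α ^ 2 / B.lam)) ^ 2

end Biot

end

open MeasureTheory

namespace Biot

variable {d : ℕ}

/-! For `c₀ = 0` the usual estimate, which discards the diffusion term, only shows that the total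
pressure error does not grow. Convergence comes from keeping that term. Write X, P, S for the
squared norms of the errors of ξ, p and ε(u). Testing the error equations with the errors and
applying Young's inequality gives 4μλ S_i + X_i ≤ α² P_i and α² P_i + 2λΔt (K∇e_p, ∇e_p) ≤ X_{i-1}.
Since K ≥ k₀ and e_p vanishes on Γp, a Poincaré inequality bounds the diffusion term below by a
multiple of P_i, so (α² + δ) P_i ≤ X_{i-1} for some δ > 0 (`Data.exists_error_bounds`). Hence X
contracts by the factor α²/(α² + δ) < 1 and drags P and S to zero.

The mesh and the time step are fixed, so δ may depend on both and a purely discrete Poincaré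
inequality suffices (`exists_poincare`): gradients of P_1 functions are constant on each cell, and a
bound passes from cell to cell because Ω is connected. -/

/-! ### Geometry of the mesh cells -/

theorem cells_finite {Ω : Set (E d)} {T : Geometry.SimplicialComplex ℝ (E d)}
    (hT : IsMesh Ω T) : (cells T).Finite := by
  refine (hT.finite.image fun s : Finset (E d) => convexHull ℝ (s : Set (E d))).subset ?_
  rintro K ⟨s, hs, -, rfl⟩
  exact ⟨s, hs, rfl⟩

theorem convex_of_mem_cells {T : Geometry.SimplicialComplex ℝ (E d)} {K : Set (E d)}
    (hK : K ∈ cells T) : Convex ℝ K := by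
  obtain ⟨s, -, -, rfl⟩ := hK
  exact convex_convexHull ℝ _

theorem isCompact_of_mem_cells {T : Geometry.SimplicialComplex ℝ (E d)} {K : Set (E d)}
    (hK : K ∈ cells T) : IsCompact K := by
  obtain ⟨s, -, -, rfl⟩ := hK
  exact s.finite_toSet.isCompact_convexHull ℝ

/-- The d + 1 vertices are affinely independent in dimension d, so they affinely span the whole
space. -/
theorem interior_nonempty_of_mem_cells {T : Geometry.SimplicialComplex ℝ (E d)} {K : Set (E d)}
    (hK : K ∈ cells T) : (interior K).Nonempty := by
  obtain ⟨s, hs, hcard, rfl⟩ := hK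
  rw [interior_convexHull_nonempty_iff_affineSpan_eq_top]
  have h := (T.indep hs).affineSpan_eq_top_iff_card_eq_finrank_add_one (k := ℝ)
  simp only [Subtype.range_coe_subtype, Fintype.card_coe, finrank_euclideanSpace,
    Fintype.card_fin] at h
  exact h.2 hcard

theorem sUnion_cells {Ω : Set (E d)} {T : Geometry.SimplicialComplex ℝ (E d)}
    (hT : IsMesh Ω T) : ⋃₀ cells T = closure Ω := by
  rw [← hT.space_eq]
  ext x
  simp only [Set.mem_sUnion, Geometry.SimplicialComplex.mem_space_iff]
  constructor
  · rintro ⟨K, ⟨s, hs, -, rfl⟩, hx⟩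
    exact ⟨s, hs, hx⟩
  · rintro ⟨s, hs, hx⟩
    obtain ⟨t, ht, hst, hcard⟩ := hT.pure s hs
    exact ⟨_, ⟨t, ht, hcard, rfl⟩, convexHull_mono (by exact_mod_cast hst) hx⟩

theorem subset_closure_of_mem_cells {Ω : Set (E d)} {T : Geometry.SimplicialComplex ℝ (E d)}
    (hT : IsMesh Ω T) {K : Set (E d)} (hK : K ∈ cells T) : K ⊆ closure Ω :=
  sUnion_cells hT ▸ Set.subset_sUnion_of_mem hK

/-- Almost every point of the domain is an interior point of a cell. -/
theorem ae_mem_interior_cell {Ω : Set (E d)} {T : Geometry.SimplicialComplex ℝ (E d)}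
    (hT : IsMesh Ω T) (hΩ : IsOpen Ω) :
    ∀ᵐ x ∂(volume.restrict Ω), x ∈ Ω ∧ ∃ K ∈ cells T, x ∈ interior K := by
  -- The frontier of a convex set is Lebesgue null, and there are only finitely many cells.
  have h0 : ∀ᵐ x ∂(volume : Measure (E d)), ∀ K ∈ cells T, x ∉ frontier K := by
    rw [ae_ball_iff (cells_finite hT).countable]
    intro K hK
    exact measure_eq_zero_iff_ae_notMem.1 ((convex_of_mem_cells hK).addHaar_frontier volume)
  filter_upwards [ae_restrict_of_ae h0, ae_restrict_mem hΩ.measurableSet] with x hx hxΩ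
  have hx' : x ∈ ⋃₀ cells T := sUnion_cells hT ▸ subset_closure hxΩ
  obtain ⟨K, hK, hxK⟩ := hx'
  refine ⟨hxΩ, K, hK, ?_⟩
  by_contra hni
  exact hx K hK ⟨subset_closure hxK, hni⟩

/-! ### Regularity of Lagrange functions -/

theorem contDiff_mvPolynomial_eval (q : MvPolynomial (Fin d) ℝ) :
    ContDiff ℝ 1 (fun x : E d => MvPolynomial.eval (fun j => x j) q) := by
  induction q using MvPolynomial.induction_on with
  | C a => simpa using contDiff_const
  | add p q hp hq => simpa using hp.add hq
  | mul_X p j hp =>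
    simp only [map_mul, MvPolynomial.eval_X]
    exact hp.mul (by fun_prop)

theorem mvPolynomial_eval_eq_affine (q : MvPolynomial (Fin d) ℝ) (hq : q.totalDegree ≤ 1) :
    ∃ (c : ℝ) (l : E d →L[ℝ] ℝ), ∀ x : E d,
      MvPolynomial.eval (fun j => x j) q = c + l x := by
  have hmon : ∀ m ∈ q.support, ∃ (c : ℝ) (l : E d →L[ℝ] ℝ), ∀ x : E d,
      MvPolynomial.eval (fun j => x j) (MvPolynomial.monomial m (q.coeff m)) = c + l x := by
    intro m hm
    have hdeg : m.degree ≤ 1 := (MvPolynomial.le_totalDegree hm).trans hq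
    obtain h | h : m.degree = 0 ∨ m.degree = 1 := by omega
    · obtain rfl := (Finsupp.degree_eq_zero_iff m).1 h
      exact ⟨q.coeff 0, 0, fun x => by simp⟩
    · obtain ⟨j, rfl⟩ := (Finsupp.sum_eq_one_iff m).1 h
      refine ⟨0, q.coeff (Finsupp.single j 1) • EuclideanSpace.proj j, fun x => ?_⟩
      simp [MvPolynomial.eval_monomial]
  choose! c l hcl using hmon
  refine ⟨∑ m ∈ q.support, c m, ∑ m ∈ q.support, l m, fun x => ?_⟩
  conv_lhs => rw [q.as_sum]
  rw [map_sum, sum_apply, ← Finset.sum_add_distrib]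
  exact Finset.sum_congr rfl fun m hm => hcl m hm x

/-- At an interior point of a cell, `v` agrees with a polynomial on a whole neighbourhood. The
polynomial is smooth up to the boundary of the cell, which yields bounds by compactness. -/
theorem lagrange.exists_poly {k : ℕ} {Ω : Set (E d)} {T : Geometry.SimplicialComplex ℝ (E d)}
    {v : E d → ℝ} (hv : v ∈ lagrange k Ω T) {K : Set (E d)} (hK : K ∈ cells T) :
    ∃ g : E d → ℝ, ContDiff ℝ 1 g ∧ ∀ x ∈ interior K, HasFDerivAt v (fderiv ℝ g x) x := by
  obtain ⟨q, -, hq⟩ := hv.2 K hK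
  have hg := contDiff_mvPolynomial_eval q
  refine ⟨_, hg, fun x hx => ?_⟩
  refine (hg.differentiable one_ne_zero x).hasFDerivAt.congr_of_eventuallyEq ?_
  filter_upwards [mem_interior_iff_mem_nhds.1 hx] with y hy using hq y hy

theorem lagrange.differentiableAt {k : ℕ} {Ω : Set (E d)}
    {T : Geometry.SimplicialComplex ℝ (E d)} {v : E d → ℝ} (hv : v ∈ lagrange k Ω T)
    {K : Set (E d)} (hK : K ∈ cells T) {x : E d} (hx : x ∈ interior K) :
    DifferentiableAt ℝ v x := by
  obtain ⟨g, -, h⟩ := lagrange.exists_poly hv hK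
  exact (h x hx).differentiableAt

theorem lagrange.memLp {k : ℕ} {Ω : Set (E d)} {T : Geometry.SimplicialComplex ℝ (E d)}
    {v : E d → ℝ} (hv : v ∈ lagrange k Ω T) (hΩ : IsOpen Ω) (hb : Bornology.IsBounded Ω) :
    MemLp v ⊤ (volume.restrict Ω) := by
  obtain ⟨C, hC⟩ := hb.isCompact_closure.exists_bound_of_continuousOn hv.1
  refine memLp_top_of_bound
    ((hv.1.mono subset_closure).aestronglyMeasurable hΩ.measurableSet) C ?_
  filter_upwards [ae_restrict_mem hΩ.measurableSet] with x hx using hC x (subset_closure hx)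

theorem lagrange.fderiv_bounded {k : ℕ} {Ω : Set (E d)} {T : Geometry.SimplicialComplex ℝ (E d)}
    {v : E d → ℝ} (hv : v ∈ lagrange k Ω T) (hT : IsMesh Ω T) :
    ∃ C, ∀ K ∈ cells T, ∀ x ∈ interior K, ‖fderiv ℝ v x‖ ≤ C := by
  have h : ∀ K ∈ cells T, ∃ C, ∀ x ∈ interior K, ‖fderiv ℝ v x‖ ≤ C := by
    intro K hK
    obtain ⟨g, hg, hd⟩ := lagrange.exists_poly hv hK
    obtain ⟨C, hC⟩ := (isCompact_of_mem_cells hK).exists_bound_of_continuousOn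
      (hg.continuous_fderiv one_ne_zero).continuousOn
    exact ⟨C, fun x hx => (hd x hx).fderiv ▸ hC x (interior_subset hx)⟩
  choose! C hC using h
  obtain ⟨M, hM⟩ := ((cells_finite hT).image C).bddAbove
  exact ⟨M, fun K hK x hx => (hC K hK x hx).trans (hM ⟨K, hK, rfl⟩)⟩

theorem lagrange.memLp_fderiv {k : ℕ} {Ω : Set (E d)} {T : Geometry.SimplicialComplex ℝ (E d)}
    {v : E d → ℝ} (hv : v ∈ lagrange k Ω T) (hT : IsMesh Ω T) (hΩ : IsOpen Ω) :
    MemLp (fderiv ℝ v) ⊤ (volume.restrict Ω) := by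
  obtain ⟨C, hC⟩ := lagrange.fderiv_bounded hv hT
  refine memLp_top_of_bound (measurable_fderiv ℝ v).aestronglyMeasurable C ?_
  filter_upwards [ae_mem_interior_cell hT hΩ] with x ⟨_, K, hK, hx⟩ using hC K hK x hx

theorem lagrange.sub {k : ℕ} {Ω : Set (E d)} {T : Geometry.SimplicialComplex ℝ (E d)}
    {v w : E d → ℝ} (hv : v ∈ lagrange k Ω T) (hw : w ∈ lagrange k Ω T) :
    v - w ∈ lagrange k Ω T := by
  refine ⟨hv.1.sub hw.1, fun K hK => ?_⟩
  obtain ⟨q, hqd, hq⟩ := hv.2 K hK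
  obtain ⟨r, hrd, hr⟩ := hw.2 K hK
  exact ⟨q - r, (MvPolynomial.totalDegree_sub q r).trans (max_le hqd hrd),
    fun x hx => by simp [hq x hx, hr x hx]⟩

theorem Mh.sub {Ω Γp : Set (E d)} {T : Geometry.SimplicialComplex ℝ (E d)}
    {v w : E d → ℝ} (hv : v ∈ Mh Ω Γp T) (hw : w ∈ Mh Ω Γp T) : v - w ∈ Mh Ω Γp T :=
  ⟨lagrange.sub hv.1 hw.1, fun x hx => by simp [hv.2 x hx, hw.2 x hx]⟩

theorem Vh.sub {Ω Γd : Set (E d)} {T : Geometry.SimplicialComplex ℝ (E d)}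
    {v w : E d → E d} (hv : v ∈ Vh Ω Γd T) (hw : w ∈ Vh Ω Γd T) : v - w ∈ Vh Ω Γd T :=
  ⟨fun i => lagrange.sub (hv.1 i) (hw.1 i), fun x hx => by simp [hv.2 x hx, hw.2 x hx]⟩

/-! ### Discrete Poincaré–Friedrichs inequality -/

/-- The squared `L²(Ω)` norm of the gradient. -/
noncomputable def dirichlet (Ω : Set (E d)) (p : E d → ℝ) : ℝ :=
  ∫ x in Ω, ‖fderiv ℝ p x‖ ^ 2

theorem dirichlet_nonneg (Ω : Set (E d)) (p : E d → ℝ) : 0 ≤ dirichlet Ω p :=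
  integral_nonneg fun _ => by positivity

theorem isFiniteMeasure_restrict {Ω : Set (E d)} (hb : Bornology.IsBounded Ω) :
    IsFiniteMeasure ((volume : Measure (E d)).restrict Ω) :=
  ⟨by simpa using hb.measure_lt_top⟩

theorem integrable_norm_fderiv_sq {Ω : Set (E d)} {T : Geometry.SimplicialComplex ℝ (E d)}
    {k : ℕ} {p : E d → ℝ} (hp : p ∈ lagrange k Ω T) (hT : IsMesh Ω T) (hΩ : IsOpen Ω)
    (hb : Bornology.IsBounded Ω) :
    Integrable (fun x => ‖fderiv ℝ p x‖ ^ 2) (volume.restrict Ω) := by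
  have := isFiniteMeasure_restrict hb
  exact ((lagrange.memLp_fderiv hp hT hΩ).mono_exponent (p := 2) le_top).integrable_norm_pow
    two_ne_zero

/-- On each cell the oscillation of a piecewise affine function is controlled by its
Dirichlet energy. -/
theorem exists_oscillation_bound {Ω : Set (E d)} {T : Geometry.SimplicialComplex ℝ (E d)}
    (hT : IsMesh Ω T) (hΩ : IsOpen Ω) (hb : Bornology.IsBounded Ω) {K : Set (E d)}
    (hK : K ∈ cells T) :
    ∃ C, 0 ≤ C ∧ ∀ p ∈ lagrange 1 Ω T, ∀ x ∈ K, ∀ y ∈ K,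
      |p x - p y| ≤ C * √(dirichlet Ω p) := by
  -- Cells lie in `closure Ω`, so the interior of `K` is not assumed to lie in `Ω`; the energy is
  -- only integrated over `Ω`.
  set U := interior K ∩ Ω with hU
  have hUo : IsOpen U := isOpen_interior.inter hΩ
  have hUne : U.Nonempty := by
    obtain ⟨x, hx⟩ := interior_nonempty_of_mem_cells hK
    exact mem_closure_iff.1 (subset_closure_of_mem_cells hT hK (interior_subset hx)) _
      isOpen_interior hx
  have hUfin : volume U ≠ ⊤ := ((hb.subset Set.inter_subset_right).measure_lt_top).ne
  have hm : 0 < volume.real U := ENNReal.toReal_pos (hUo.measure_pos volume hUne).ne' hUfin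
  -- The gradient is a constant `l` on the cell, so ‖l‖² |U| is at most the energy, and the
  -- oscillation is at most ‖l‖ diam K.
  refine ⟨Metric.diam K / √(volume.real U), by positivity, fun p hp x hx y hy => ?_⟩
  obtain ⟨q, hqd, hq⟩ := hp.2 K hK
  obtain ⟨c, l, hcl⟩ := mvPolynomial_eval_eq_affine q hqd
  have hpl : ∀ z ∈ K, p z = c + l z := fun z hz => (hq z hz).trans (hcl z)
  have hd : ∀ z ∈ interior K, fderiv ℝ p z = l := by
    intro z hz
    refine HasFDerivAt.fderiv ((l.hasFDerivAt.const_add c).congr_of_eventuallyEq ?_)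
    filter_upwards [mem_interior_iff_mem_nhds.1 hz] with w hw using hpl w hw
  have hle : ‖l‖ ^ 2 * volume.real U ≤ dirichlet Ω p := by
    calc ‖l‖ ^ 2 * volume.real U = ∫ z in U, ‖fderiv ℝ p z‖ ^ 2 := by
          rw [setIntegral_congr_fun (g := fun _ => ‖l‖ ^ 2) hUo.measurableSet
            (fun z hz => by simp only [hd z hz.1])]
          simp [mul_comm]
      _ ≤ dirichlet Ω p :=
          setIntegral_mono_set (integrable_norm_fderiv_sq hp hT hΩ hb)
            (Filter.Eventually.of_forall fun _ => by positivity)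
            Set.inter_subset_right.eventuallyLE
  have hl : ‖l‖ ≤ √(dirichlet Ω p) / √(volume.real U) := by
    rw [← Real.sqrt_div (dirichlet_nonneg Ω p)]
    exact Real.le_sqrt_of_sq_le ((le_div_iff₀ hm).2 hle)
  calc |p x - p y| = ‖l (x - y)‖ := by
        rw [hpl x hx, hpl y hy, map_sub, Real.norm_eq_abs]; ring_nf
    _ ≤ ‖l‖ * ‖x - y‖ := l.le_opNorm _
    _ ≤ √(dirichlet Ω p) / √(volume.real U) * Metric.diam K := by
        gcongr
        rw [← dist_eq_norm]
        exact Metric.dist_le_diam_of_mem (isCompact_of_mem_cells hK).isBounded hx hy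
    _ = _ := by ring

/-- A piecewise affine function that vanishes at a given point of `closure Ω` is bounded
by its Dirichlet energy: the bound propagates from cell to neighbouring cell. -/
theorem exists_sup_bound {Ω : Set (E d)} {T : Geometry.SimplicialComplex ℝ (E d)}
    (hT : IsMesh Ω T) (hΩ : IsOpen Ω) (hb : Bornology.IsBounded Ω) (hc : IsPreconnected Ω)
    {x₀ : E d} (hx₀ : x₀ ∈ closure Ω) :
    ∃ C, 0 ≤ C ∧ ∀ p ∈ lagrange 1 Ω T, p x₀ = 0 → ∀ x ∈ closure Ω,
      |p x| ≤ C * √(dirichlet Ω p) := by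
  let Good : Set (E d) → Prop := fun K => ∃ C, 0 ≤ C ∧ ∀ p ∈ lagrange 1 Ω T, p x₀ = 0 →
    ∀ x ∈ K, |p x| ≤ C * √(dirichlet Ω p)
  have hstep : ∀ K ∈ cells T, ∀ z ∈ K, Good {z} → Good K := by
    rintro K hK z hz ⟨C, hC, h⟩
    obtain ⟨C', hC', h'⟩ := exists_oscillation_bound hT hΩ hb hK
    refine ⟨C' + C, by positivity, fun p hp hp0 x hx => ?_⟩
    calc |p x| = |(p x - p z) + p z| := by ring_nf
      _ ≤ |p x - p z| + |p z| := abs_add_le _ _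
      _ ≤ _ := by rw [add_mul]; exact add_le_add (h' p hp x hx z hz) (h p hp hp0 z rfl)
  have hmono : ∀ K, ∀ z ∈ K, Good K → Good {z} := by
    rintro K z hz ⟨C, hC, h⟩
    exact ⟨C, hC, fun p hp hp0 x hx => h p hp hp0 x (Set.mem_singleton_iff.1 hx ▸ hz)⟩
  have hclosed : ∀ P : Set (E d) → Prop, IsClosed (⋃₀ {K | K ∈ cells T ∧ P K}) := by
    intro P
    rw [Set.sUnion_eq_biUnion]
    exact ((cells_finite hT).subset fun K hK => hK.1).isClosed_biUnion
      fun K hK => (isCompact_of_mem_cells hK.1).isClosed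
  -- If some cell were bad, the good and the bad cells would form two nonempty closed sets covering
  -- the connected set `closure Ω`. They would share a point, and the bound at that point makes the
  -- bad cell good.
  have hall : ∀ K ∈ cells T, Good K := by
    by_contra! hbad
    obtain ⟨K, hK, hKbad⟩ := hbad
    obtain ⟨K₀, hK₀, hx₀K⟩ : x₀ ∈ ⋃₀ cells T := sUnion_cells hT ▸ hx₀
    have hG₀ : Good K₀ := hstep K₀ hK₀ x₀ hx₀K
      ⟨0, le_rfl, fun p _ hp0 x hx => by rw [Set.mem_singleton_iff.1 hx, hp0]; simp⟩
    obtain ⟨y, hy⟩ := interior_nonempty_of_mem_cells hK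
    have hyK := interior_subset hy
    obtain ⟨z, -, ⟨K₁, ⟨hK₁, hg⟩, hz₁⟩, ⟨K₂, ⟨hK₂, hnb⟩, hz₂⟩⟩ :=
      isPreconnected_closed_iff.1 hc.closure _ _ (hclosed Good) (hclosed fun K => ¬ Good K)
        (by
          intro w hw
          obtain ⟨L, hL, hwL⟩ : w ∈ ⋃₀ cells T := sUnion_cells hT ▸ hw
          by_cases hg : Good L
          · exact Or.inl ⟨L, ⟨hL, hg⟩, hwL⟩
          · exact Or.inr ⟨L, ⟨hL, hg⟩, hwL⟩)
        ⟨x₀, hx₀, K₀, ⟨hK₀, hG₀⟩, hx₀K⟩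
        ⟨y, subset_closure_of_mem_cells hT hK hyK, K, ⟨hK, hKbad⟩, hyK⟩
    exact hnb (hstep K₂ hK₂ z hz₂ (hmono K₁ z hz₁ hg))
  choose! C hC0 hC using hall
  obtain ⟨M, hM⟩ := ((cells_finite hT).image C).bddAbove
  obtain ⟨K₀, hK₀, -⟩ : x₀ ∈ ⋃₀ cells T := sUnion_cells hT ▸ hx₀
  refine ⟨M, (hC0 K₀ hK₀).trans (hM ⟨K₀, hK₀, rfl⟩), fun p hp hp0 x hx => ?_⟩
  obtain ⟨K, hK, hxK⟩ : x ∈ ⋃₀ cells T := sUnion_cells hT ▸ hx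
  exact (hC K hK p hp hp0 x hxK).trans (by gcongr; exact hM ⟨K, hK, rfl⟩)

/-- The discrete Poincaré–Friedrichs inequality. -/
theorem exists_poincare {Ω : Set (E d)} {T : Geometry.SimplicialComplex ℝ (E d)}
    (hT : IsMesh Ω T) (hΩ : IsOpen Ω) (hb : Bornology.IsBounded Ω) (hc : IsPreconnected Ω)
    {Γp : Set (E d)} (hΓ : (Γp ∩ closure Ω).Nonempty) :
    ∃ C, 0 < C ∧ ∀ p ∈ Mh Ω Γp T, innerS Ω p p ≤ C * dirichlet Ω p := by
  obtain ⟨x₀, hx₀, hx₀'⟩ := hΓ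
  obtain ⟨C, hC, h⟩ := exists_sup_bound hT hΩ hb hc hx₀'
  -- The `+ 1` makes the constant strictly positive, since it is later divided by.
  refine ⟨C ^ 2 * volume.real Ω + 1, by positivity, fun p hp => ?_⟩
  have hbd : ∀ x ∈ Ω, p x * p x ≤ C ^ 2 * dirichlet Ω p := by
    intro x hx
    have hx' := h p hp.1 (hp.2 x₀ hx₀) x (subset_closure hx)
    calc p x * p x = |p x| ^ 2 := by rw [sq_abs, sq]
      _ ≤ (C * √(dirichlet Ω p)) ^ 2 := by gcongr
      _ = _ := by rw [mul_pow, Real.sq_sqrt (dirichlet_nonneg Ω p)]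
  have hle : innerS Ω p p ≤ ∫ _ in Ω, C ^ 2 * dirichlet Ω p := by
    refine integral_mono_of_nonneg (Filter.Eventually.of_forall fun x => mul_self_nonneg _)
      (integrableOn_const hb.measure_lt_top.ne) ?_
    filter_upwards [ae_restrict_mem hΩ.measurableSet] with x hx using hbd x hx
  rw [setIntegral_const, smul_eq_mul] at hle
  have := dirichlet_nonneg Ω p
  nlinarith

/-! ### The scalar inner product on bounded functions -/

theorem integrable_mul_of_memLp_top {Ω : Set (E d)} (hb : Bornology.IsBounded Ω)
    {f g : E d → ℝ} (hf : MemLp f ⊤ (volume.restrict Ω)) (hg : MemLp g ⊤ (volume.restrict Ω)) :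
    Integrable (fun x => f x * g x) (volume.restrict Ω) := by
  have := isFiniteMeasure_restrict hb
  exact (MemLp.mul' (r := ⊤) hg hf).integrable le_top

theorem innerS_nonneg (Ω : Set (E d)) (f : E d → ℝ) : 0 ≤ innerS Ω f f :=
  integral_nonneg fun x => mul_self_nonneg (f x)

theorem innerS_comm (Ω : Set (E d)) (f g : E d → ℝ) : innerS Ω f g = innerS Ω g f := by
  simp only [innerS, mul_comm]

theorem innerS_sub_left {Ω : Set (E d)} (hb : Bornology.IsBounded Ω) {f g k : E d → ℝ}
    (hf : MemLp f ⊤ (volume.restrict Ω)) (hg : MemLp g ⊤ (volume.restrict Ω))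
    (hk : MemLp k ⊤ (volume.restrict Ω)) :
    innerS Ω (f - g) k = innerS Ω f k - innerS Ω g k := by
  simp only [innerS, Pi.sub_apply, sub_mul]
  exact integral_sub (integrable_mul_of_memLp_top hb hf hk) (integrable_mul_of_memLp_top hb hg hk)

/-- Integrate (t f - g)² ≥ 0. -/
theorem innerS_young {Ω : Set (E d)} (hb : Bornology.IsBounded Ω) {f g : E d → ℝ}
    (hf : MemLp f ⊤ (volume.restrict Ω)) (hg : MemLp g ⊤ (volume.restrict Ω)) (t : ℝ) :
    2 * t * innerS Ω f g ≤ t ^ 2 * innerS Ω f f + innerS Ω g g := by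
  have hff := integrable_mul_of_memLp_top hb hf hf
  have hfg := integrable_mul_of_memLp_top hb hf hg
  have hgg := integrable_mul_of_memLp_top hb hg hg
  simp only [innerS]
  rw [← integral_const_mul, ← integral_const_mul, ← integral_add (hff.const_mul _) hgg]
  refine integral_mono (hfg.const_mul _) ((hff.const_mul _).add hgg) fun x => ?_
  simp only
  nlinarith [sq_nonneg (t * f x - g x)]

/-! ### Divergence and strain of discrete displacements -/

theorem pderiv_eq_of_differentiableAt {u : E d → E d} {x : E d}
    (hu : ∀ i, DifferentiableAt ℝ (fun y => u y i) x) (i j : Fin d) :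
    pderiv u i j x = fderiv ℝ (fun y => u y i) x (EuclideanSpace.single j 1) := by
  have h : HasFDerivAt (fun y => u y i)
      ((EuclideanSpace.proj i : E d →L[ℝ] ℝ).comp (fderiv ℝ u x)) x :=
    (EuclideanSpace.proj i : E d →L[ℝ] ℝ).hasFDerivAt.comp x
      ((differentiableAt_euclidean.2 hu).hasFDerivAt)
  rw [h.fderiv]
  rfl

theorem Vh.differentiableAt {Ω Γd : Set (E d)} {T : Geometry.SimplicialComplex ℝ (E d)}
    {u : E d → E d} (hu : u ∈ Vh Ω Γd T) {K : Set (E d)} (hK : K ∈ cells T) {x : E d}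
    (hx : x ∈ interior K) (i : Fin d) : DifferentiableAt ℝ (fun y => u y i) x :=
  lagrange.differentiableAt (hu.1 i) hK hx

theorem Vh.memLp_pderiv {Ω Γd : Set (E d)} {T : Geometry.SimplicialComplex ℝ (E d)}
    {u : E d → E d} (hu : u ∈ Vh Ω Γd T) (hT : IsMesh Ω T) (hΩ : IsOpen Ω) (i j : Fin d) :
    MemLp (pderiv u i j) ⊤ (volume.restrict Ω) := by
  have h := (ContinuousLinearMap.apply ℝ ℝ (EuclideanSpace.single j (1 : ℝ))).comp_memLp'
    (lagrange.memLp_fderiv (hu.1 i) hT hΩ)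
  refine h.ae_eq ?_
  filter_upwards [ae_mem_interior_cell hT hΩ] with x ⟨_, K, hK, hx⟩
  exact (pderiv_eq_of_differentiableAt (fun i => Vh.differentiableAt hu hK hx i) i j).symm

theorem Vh.memLp_divg {Ω Γd : Set (E d)} {T : Geometry.SimplicialComplex ℝ (E d)}
    {u : E d → E d} (hu : u ∈ Vh Ω Γd T) (hT : IsMesh Ω T) (hΩ : IsOpen Ω) :
    MemLp (divg u) ⊤ (volume.restrict Ω) :=
  memLp_finsetSum _ fun i _ => Vh.memLp_pderiv hu hT hΩ i i

theorem Vh.memLp_strain {Ω Γd : Set (E d)} {T : Geometry.SimplicialComplex ℝ (E d)}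
    {u : E d → E d} (hu : u ∈ Vh Ω Γd T) (hT : IsMesh Ω T) (hΩ : IsOpen Ω) (i j : Fin d) :
    MemLp (fun x => strain u x i j) ⊤ (volume.restrict Ω) := by
  have h := ((Vh.memLp_pderiv hu hT hΩ i j).add (Vh.memLp_pderiv hu hT hΩ j i)).mul_const 2⁻¹
  simpa only [strain, Matrix.of_apply, div_eq_mul_inv, Pi.add_apply] using h

/-- Additivity of `fderiv` needs differentiability, which is available in the cell interiors, hence
almost everywhere. -/
theorem Vh.pderiv_sub {Ω Γd : Set (E d)} {T : Geometry.SimplicialComplex ℝ (E d)}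
    {u v : E d → E d} (hu : u ∈ Vh Ω Γd T) (hv : v ∈ Vh Ω Γd T) (hT : IsMesh Ω T)
    (hΩ : IsOpen Ω) :
    ∀ᵐ x ∂(volume.restrict Ω), ∀ i j, pderiv (u - v) i j x = pderiv u i j x - pderiv v i j x := by
  filter_upwards [ae_mem_interior_cell hT hΩ] with x ⟨_, K, hK, hx⟩ i j
  have hu' := differentiableAt_euclidean.2 fun i => Vh.differentiableAt hu hK hx i
  have hv' := differentiableAt_euclidean.2 fun i => Vh.differentiableAt hv hK hx i
  simp [pderiv, fderiv_sub hu' hv']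

theorem innerS_divg_sub {Ω Γd : Set (E d)} {T : Geometry.SimplicialComplex ℝ (E d)}
    {u v : E d → E d} (hu : u ∈ Vh Ω Γd T) (hv : v ∈ Vh Ω Γd T) (hT : IsMesh Ω T)
    (hΩ : IsOpen Ω) (hb : Bornology.IsBounded Ω) {φ : E d → ℝ}
    (hφ : MemLp φ ⊤ (volume.restrict Ω)) :
    innerS Ω (divg (u - v)) φ = innerS Ω (divg u) φ - innerS Ω (divg v) φ := by
  rw [← innerS_sub_left hb (Vh.memLp_divg hu hT hΩ) (Vh.memLp_divg hv hT hΩ) hφ]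
  refine integral_congr_ae ?_
  filter_upwards [Vh.pderiv_sub hu hv hT hΩ] with x hx
  simp [divg, hx]

theorem innerM_strain_sub {Ω Γd : Set (E d)} {T : Geometry.SimplicialComplex ℝ (E d)}
    {u v w : E d → E d} (hu : u ∈ Vh Ω Γd T) (hv : v ∈ Vh Ω Γd T) (hw : w ∈ Vh Ω Γd T)
    (hT : IsMesh Ω T) (hΩ : IsOpen Ω) (hb : Bornology.IsBounded Ω) :
    innerM Ω (strain (u - v)) (strain w)
      = innerM Ω (strain u) (strain w) - innerM Ω (strain v) (strain w) := by
  have hint : ∀ z ∈ Vh Ω Γd T, Integrable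
      (fun x => ∑ i, ∑ j, strain z x i j * strain w x i j) (volume.restrict Ω) := fun z hz =>
    integrable_finsetSum _ fun i _ => integrable_finsetSum _ fun j _ =>
      integrable_mul_of_memLp_top hb (Vh.memLp_strain hz hT hΩ i j)
        (Vh.memLp_strain hw hT hΩ i j)
  rw [innerM, innerM, innerM, ← integral_sub (hint u hu) (hint v hv)]
  refine integral_congr_ae ?_
  filter_upwards [Vh.pderiv_sub hu hv hT hΩ] with x hx
  simp only [← Finset.sum_sub_distrib]
  refine Finset.sum_congr rfl fun i _ => Finset.sum_congr rfl fun j _ => ?_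
  simp only [strain, Matrix.of_apply, hx]
  ring

theorem innerM_nonneg (Ω : Set (E d)) (A : E d → Matrix (Fin d) (Fin d) ℝ) :
    0 ≤ innerM Ω A A :=
  integral_nonneg fun _ => Finset.sum_nonneg fun _ _ => Finset.sum_nonneg fun _ _ =>
    mul_self_nonneg _

/-! ### The diffusion form -/

theorem integrable_diffusion {B : Data d} (hB : B.Admissible)
    {T : Geometry.SimplicialComplex ℝ (E d)} (hT : IsMesh B.Ω T) {k : ℕ} {p ψ : E d → ℝ}
    (hp : p ∈ lagrange k B.Ω T) (hψ : ψ ∈ lagrange k B.Ω T) :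
    Integrable (fun x => B.kappa x * inner ℝ (gradient p x) (gradient ψ x))
      (volume.restrict B.Ω) := by
  have hΩ := hB.domain.1
  have hb := hB.domain.2.2.1
  have hgrad : ∀ q ∈ lagrange k B.Ω T, MemLp (gradient q) ⊤ (volume.restrict B.Ω) := fun q hq =>
    (InnerProductSpace.toDual ℝ (E d)).symm.toLinearIsometry.toContinuousLinearMap.comp_memLp'
      (lagrange.memLp_fderiv hq hT hΩ)
  have hin : Integrable (fun x => inner ℝ (gradient p x) (gradient ψ x))
      (volume.restrict B.Ω) :=
    (integrable_mul_of_memLp_top hb (hgrad p hp).norm (hgrad ψ hψ).norm).mono'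
      ((hgrad p hp).1.inner (hgrad ψ hψ).1)
      (Filter.Eventually.of_forall fun x => norm_inner_le_norm _ _)
  obtain ⟨k₀, k₁, hk₀, hk⟩ := hB.kappa_bdd
  refine hin.bdd_mul hB.kappa_meas.aestronglyMeasurable (c := k₁) ?_
  filter_upwards [ae_restrict_mem hΩ.measurableSet] with x hx
  rw [Real.norm_of_nonneg (hk₀.le.trans (hk x hx).1)]
  exact (hk x hx).2

theorem Data.diffusion_sub {B : Data d} (hB : B.Admissible)
    {T : Geometry.SimplicialComplex ℝ (E d)} (hT : IsMesh B.Ω T) {k : ℕ} {p q ψ : E d → ℝ}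
    (hp : p ∈ lagrange k B.Ω T) (hq : q ∈ lagrange k B.Ω T) (hψ : ψ ∈ lagrange k B.Ω T) :
    B.diffusion (p - q) ψ = B.diffusion p ψ - B.diffusion q ψ := by
  rw [Data.diffusion, Data.diffusion, Data.diffusion,
    ← integral_sub (integrable_diffusion hB hT hp hψ) (integrable_diffusion hB hT hq hψ)]
  refine integral_congr_ae ?_
  filter_upwards [ae_mem_interior_cell hT hB.domain.1] with x ⟨_, K, hK, hx⟩
  simp only [gradient, fderiv_sub (lagrange.differentiableAt hp hK hx)
    (lagrange.differentiableAt hq hK hx), map_sub, inner_sub_left, mul_sub]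

theorem Data.exists_diffusion_coercive {B : Data d} (hB : B.Admissible)
    {T : Geometry.SimplicialComplex ℝ (E d)} (hT : IsMesh B.Ω T) :
    ∃ k₀, 0 < k₀ ∧ ∀ (k : ℕ), ∀ p ∈ lagrange k B.Ω T,
      k₀ * dirichlet B.Ω p ≤ B.diffusion p p := by
  have hΩ := hB.domain.1
  have hb := hB.domain.2.2.1
  obtain ⟨k₀, k₁, hk₀, hk⟩ := hB.kappa_bdd
  refine ⟨k₀, hk₀, fun k p hp => ?_⟩
  rw [dirichlet, ← integral_const_mul]
  refine setIntegral_mono_on ((integrable_norm_fderiv_sq hp hT hΩ hb).const_mul _)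
    (integrable_diffusion hB hT hp hp) hΩ.measurableSet fun x hx => ?_
  rw [real_inner_self_eq_norm_sq, gradient, LinearIsometryEquiv.norm_map]
  gcongr
  exact (hk x hx).1

/-! ### Error estimates for one iteration -/

/-- The difference of two solutions of the momentum and total pressure equations satisfies the
energy identity. -/
theorem Data.energy_identity {B : Data d} (hB : B.Admissible)
    {T : Geometry.SimplicialComplex ℝ (E d)} (hT : IsMesh B.Ω T)
    {u₁ u₂ : E d → E d} {ξ₁ ξ₂ p₁ p₂ : E d → ℝ}
    (hu₁ : u₁ ∈ Vh B.Ω B.Γd T) (hu₂ : u₂ ∈ Vh B.Ω B.Γd T)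
    (hξ₁ : ξ₁ ∈ Wh B.Ω T) (hξ₂ : ξ₂ ∈ Wh B.Ω T)
    (hp₁ : p₁ ∈ Mh B.Ω B.Γp T) (hp₂ : p₂ ∈ Mh B.Ω B.Γp T)
    (hm₁ : B.Momentum T u₁ ξ₁) (hm₂ : B.Momentum T u₂ ξ₂)
    (ht₁ : B.TotalPressure T u₁ ξ₁ p₁) (ht₂ : B.TotalPressure T u₂ ξ₂ p₂) :
    2 * B.mu * innerM B.Ω (strain (u₁ - u₂)) (strain (u₁ - u₂))
        + 1 / B.lam * innerS B.Ω (ξ₁ - ξ₂) (ξ₁ - ξ₂)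
      = B.α / B.lam * innerS B.Ω (p₁ - p₂) (ξ₁ - ξ₂) := by
  have hΩ := hB.domain.1
  have hb := hB.domain.2.2.1
  have hu := Vh.sub hu₁ hu₂
  have hξ : ξ₁ - ξ₂ ∈ Wh B.Ω T := lagrange.sub hξ₁ hξ₂
  have mξ := lagrange.memLp hξ hΩ hb
  have mu := Vh.memLp_divg hu hT hΩ
  have e₁ := hm₁ _ hu
  have e₂ := hm₂ _ hu
  have e₃ := ht₁ _ hξ
  have e₄ := ht₂ _ hξ
  have s₁ := innerM_strain_sub hu₁ hu₂ hu hT hΩ hb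
  have s₂ := innerS_sub_left hb (lagrange.memLp hξ₁ hΩ hb) (lagrange.memLp hξ₂ hΩ hb) mu
  have s₃ := innerS_divg_sub hu₁ hu₂ hT hΩ hb mξ
  have s₄ := innerS_sub_left hb (lagrange.memLp hξ₁ hΩ hb) (lagrange.memLp hξ₂ hΩ hb) mξ
  have s₅ := innerS_sub_left hb (lagrange.memLp hp₁.1 hΩ hb) (lagrange.memLp hp₂.1 hΩ hb) mξ
  rw [innerS_comm B.Ω (divg (u₁ - u₂)) (ξ₁ - ξ₂)] at s₃
  -- Test with v = e_u and φ = e_ξ: the loads drop out on subtraction, and the coupling terms (e_ξ,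
  -- div e_u) cancel on addition.
  linear_combination (2 * B.mu) * s₁ + e₁ - e₂ + e₃ - e₄ - s₂ + s₃ + (1 / B.lam) * s₄
    - (B.α / B.lam) * s₅

/-- The error of the total pressure is controlled by the error of the fluid pressure, which in
turn is strictly smaller than the previous error of the total pressure. -/
theorem Data.exists_error_bounds {B : Data d} (hB : B.Admissible) (hc : B.c₀ = 0)
    {T : Geometry.SimplicialComplex ℝ (E d)} (hT : IsMesh B.Ω T) {Δt : ℝ} (hΔt : 0 < Δt)
    {N : ℕ} {u : ℕ → E d → E d} {ξ p : ℕ → E d → ℝ} (hcoupled : B.IsCoupled T Δt N u ξ p)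
    {n : ℕ} (hn1 : 1 ≤ n) (hnN : n ≤ N)
    {uIt : ℕ → E d → E d} {ξIt pIt : ℕ → E d → ℝ}
    (hiter : B.IsIterative T Δt (u (n - 1)) (ξ (n - 1)) (p (n - 1)) uIt ξIt pIt) :
    ∃ δ, 0 < δ ∧ ∀ i, 1 ≤ i →
      4 * B.mu * B.lam * innerM B.Ω (strain (uIt i - u n)) (strain (uIt i - u n))
          + innerS B.Ω (ξIt i - ξ n) (ξIt i - ξ n)
        ≤ B.α ^ 2 * innerS B.Ω (pIt i - p n) (pIt i - p n) ∧
      (B.α ^ 2 + δ) * innerS B.Ω (pIt i - p n) (pIt i - p n)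
        ≤ innerS B.Ω (ξIt (i - 1) - ξ n) (ξIt (i - 1) - ξ n) := by
  have hΩ := hB.domain.1
  have hb := hB.domain.2.2.1
  have hlam := hB.lam_pos
  -- A single zero of the pressure error is enough to start the cell-to-cell propagation.
  have hΓ : (B.Γp ∩ closure B.Ω).Nonempty := by
    obtain ⟨x, hx⟩ := nonempty_of_measure_ne_zero hB.pos_p.ne'
    exact ⟨x, hx, frontier_subset_closure (hB.union_pf ▸ Or.inl hx)⟩
  obtain ⟨C, hC, hpoin⟩ := exists_poincare hT hΩ hb hB.domain.2.1.isPreconnected hΓ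
  obtain ⟨k₀, hk₀, hcoer⟩ := Data.exists_diffusion_coercive hB hT
  -- This is the factor in 2λΔt (K∇e_p, ∇e_p) ≥ δ ‖e_p‖², from coercivity `k₀` and Poincaré constant
  -- `C`.
  refine ⟨2 * B.lam * Δt * k₀ / C, by positivity, fun i hi => ?_⟩
  -- Index 0 is needed because the first iteration uses it; there the iterate is the previous time
  -- level.
  have hξIt : ∀ j, ξIt j ∈ Wh B.Ω T := by
    intro j
    obtain rfl | hj := Nat.eq_zero_or_pos j
    · rw [hiter.ξ_init]
      exact hcoupled.ξ_mem _ (by omega)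
    · exact hiter.ξ_mem j hj
  have hξn := hcoupled.ξ_mem n hnN
  have hpn := hcoupled.p_mem n hnN
  have hpi := hiter.p_mem i hi
  have hp := Mh.sub hpi hpn
  have mξ : ∀ j, MemLp (ξIt j - ξ n) ⊤ (volume.restrict B.Ω) := fun j =>
    lagrange.memLp (lagrange.sub (hξIt j) hξn) hΩ hb
  have mp := lagrange.memLp hp.1 hΩ hb
  constructor
  · have h := Data.energy_identity hB hT (hiter.u_mem i hi) (hcoupled.u_mem n hnN) (hξIt i) hξn
      hpi hpn (hiter.momentum i hi) (hcoupled.momentum n hn1 hnN) (hiter.totalPressure i hi)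
      (hcoupled.totalPressure n hn1 hnN)
    -- With weight α, one of the two copies of ‖e_ξ‖² in the doubled identity absorbs the Young
    -- term.
    have hy := innerS_young hb mp (mξ i) B.α
    field_simp at h
    linarith
  · have m₀ := lagrange.memLp (hcoupled.ξ_mem (n - 1) (by omega)) hΩ hb
    have mi := lagrange.memLp (hξIt (i - 1)) hΩ hb
    have mn := lagrange.memLp hξn hΩ hb
    have e₁ := hiter.pressure i hi _ hp
    have e₂ := hcoupled.pressure n hn1 hnN _ hp
    have s₁ := innerS_sub_left hb mi m₀ mp
    have s₂ := innerS_sub_left hb mi mn mp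
    have s₃ := innerS_sub_left hb (lagrange.memLp hpi.1 hΩ hb) (lagrange.memLp hpn.1 hΩ hb) mp
    have s₄ := Data.diffusion_sub hB hT hpi.1 hpn.1 hp.1
    have hy := innerS_young hb mp (mξ (i - 1)) B.α
    rw [innerS_comm B.Ω (pIt i - p n) (ξIt (i - 1) - ξ n)] at hy
    rw [hc, zero_add] at e₁ e₂
    -- Subtracting the pressure equations tested with e_p removes the loads and all values from time
    -- level n - 1.
    have key : B.α ^ 2 / B.lam * innerS B.Ω (pIt i - p n) (pIt i - p n)
        + Δt * B.diffusion (pIt i - p n) (pIt i - p n)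
        = B.α / B.lam * innerS B.Ω (ξIt (i - 1) - ξ n) (pIt i - p n) := by
      linear_combination e₁ - e₂ + (B.α / B.lam) * s₁ - (B.α / B.lam) * s₂
        + (B.α ^ 2 / B.lam) * s₃ + Δt * s₄
    field_simp at key
    have hD : 2 * B.lam * Δt * k₀ / C * innerS B.Ω (pIt i - p n) (pIt i - p n)
        ≤ 2 * B.lam * Δt * B.diffusion (pIt i - p n) (pIt i - p n) := by
      calc _ ≤ 2 * B.lam * Δt * k₀ / C * (C * dirichlet B.Ω (pIt i - p n)) := by
            gcongr
            exact hpoin _ hp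
        _ = 2 * B.lam * Δt * (k₀ * dirichlet B.Ω (pIt i - p n)) := by field_simp
        _ ≤ _ := by gcongr; exact hcoer 1 _ hp.1
    linarith

end Biot

/-! ### Geometric convergence of the iteration -/

theorem mainTheorem2 (d : ℕ) (hd : d = 2 ∨ d = 3)
    (B : Biot.Data d) (hB : B.Admissible) (hc : B.c₀ = 0)
    (T : Geometry.SimplicialComplex ℝ (Biot.E d)) (hT : Biot.IsMesh B.Ω T)
    (tEnd : ℝ) (htEnd : 0 < tEnd) (N : ℕ)
    (u : ℕ → Biot.E d → Biot.E d) (ξ p : ℕ → Biot.E d → ℝ)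
    (hcoupled : B.IsCoupled T (tEnd / N) N u ξ p)
    (n : ℕ) (hn1 : 1 ≤ n) (hnN : n ≤ N)
    (uIt : ℕ → Biot.E d → Biot.E d) (ξIt pIt : ℕ → Biot.E d → ℝ)
    (hiter : B.IsIterative T (tEnd / N) (u (n - 1)) (ξ (n - 1)) (p (n - 1)) uIt ξIt pIt) :
    B.contractionConst = 1 ∧
    (∀ i : ℕ, 1 ≤ i →
      Biot.normS B.Ω (ξIt i - ξ n) ≤
        B.contractionConst * Biot.normS B.Ω (ξIt (i - 1) - ξ n)) ∧
    Filter.Tendsto (fun i : ℕ => Biot.normS B.Ω (ξIt i - ξ n)) Filter.atTop (nhds 0) ∧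
    Filter.Tendsto (fun i : ℕ => Biot.normM B.Ω (Biot.strain (uIt i - u n)))
      Filter.atTop (nhds 0) ∧
    Filter.Tendsto (fun i : ℕ => Biot.normS B.Ω (pIt i - p n)) Filter.atTop (nhds 0) := by
  have hα := hB.α_pos
  have hlam := hB.lam_pos
  have hmu := hB.mu_pos
  have hN : (0 : ℝ) < N := by exact_mod_cast (by omega : 0 < N)
  have hconst : B.contractionConst = 1 := by
    rw [Biot.Data.contractionConst, hc, zero_add, div_self (by positivity), one_pow]
  obtain ⟨δ, hδ, hbound⟩ := Biot.Data.exists_error_bounds hB hc hT (div_pos htEnd hN) hcoupled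
    hn1 hnN hiter
  set X : ℕ → ℝ := fun i => Biot.innerS B.Ω (ξIt i - ξ n) (ξIt i - ξ n) with hX
  set P : ℕ → ℝ := fun i => Biot.innerS B.Ω (pIt i - p n) (pIt i - p n) with hP
  set S : ℕ → ℝ := fun i =>
    Biot.innerM B.Ω (Biot.strain (uIt i - u n)) (Biot.strain (uIt i - u n)) with hS
  have hX0 : ∀ i, 0 ≤ X i := fun i => Biot.innerS_nonneg _ _
  have hP0 : ∀ i, 0 ≤ P i := fun i => Biot.innerS_nonneg _ _
  have hS0 : ∀ i, 0 ≤ S i := fun i => Biot.innerM_nonneg _ _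
  have h₁ : ∀ i, 4 * B.mu * B.lam * S (i + 1) + X (i + 1) ≤ B.α ^ 2 * P (i + 1) := fun i =>
    (hbound (i + 1) (by omega)).1
  have h₂ : ∀ i, (B.α ^ 2 + δ) * P (i + 1) ≤ X i := fun i => (hbound (i + 1) (by omega)).2
  have hSc : ∀ i, 0 ≤ 4 * B.mu * B.lam * S i := fun i => mul_nonneg (by positivity) (hS0 i)
  -- Contraction factor for squared norms, obtained by eliminating P from the two bounds.
  set q : ℝ := B.α ^ 2 / (B.α ^ 2 + δ) with hq
  have hPq : ∀ i, B.α ^ 2 * P (i + 1) ≤ q * X i := by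
    intro i
    rw [hq, div_mul_eq_mul_div, le_div_iff₀ (by positivity)]
    nlinarith [h₂ i, sq_nonneg B.α]
  have hq0 : 0 ≤ q := by positivity
  have hq1 : q < 1 := (div_lt_one (by positivity)).2 (by linarith)
  have hXq : ∀ i, X (i + 1) ≤ q * X i := fun i => by linarith [h₁ i, hPq i, hSc (i + 1)]
  have hgeom : ∀ i, X i ≤ q ^ i * X 0 := by
    intro i
    induction i with
    | zero => simp
    | succ i ih =>
      calc X (i + 1) ≤ q * X i := hXq i
        _ ≤ q * (q ^ i * X 0) := by gcongr
        _ = q ^ (i + 1) * X 0 := by ring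
  have hXlim : Filter.Tendsto X Filter.atTop (nhds 0) := by
    refine squeeze_zero hX0 hgeom ?_
    simpa using (tendsto_pow_atTop_nhds_zero_of_lt_one hq0 hq1).mul_const (X 0)
  have hPlim : Filter.Tendsto P Filter.atTop (nhds 0) := by
    -- The bounds control P only from iteration 1 on; the initial pressure error is arbitrary.
    rw [← Filter.tendsto_add_atTop_iff_nat 1]
    refine squeeze_zero (g := fun i => q / B.α ^ 2 * X i) (fun i => hP0 _) (fun i => ?_) ?_
    · rw [div_mul_eq_mul_div, le_div_iff₀ (by positivity)]
      linarith [hPq i]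
    · simpa using hXlim.const_mul (q / B.α ^ 2)
  have hSlim : Filter.Tendsto S Filter.atTop (nhds 0) := by
    rw [← Filter.tendsto_add_atTop_iff_nat 1]
    refine squeeze_zero (g := fun i => q / (4 * B.mu * B.lam) * X i) (fun i => hS0 _)
      (fun i => ?_) ?_
    · rw [div_mul_eq_mul_div, le_div_iff₀ (by positivity)]
      linarith [hPq i, h₁ i, hX0 (i + 1)]
    · simpa using hXlim.const_mul (q / (4 * B.mu * B.lam))
  refine ⟨hconst, fun i hi => ?_, ?_, ?_, ?_⟩
  · obtain ⟨j, rfl⟩ : ∃ j, i = j + 1 := ⟨i - 1, by omega⟩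
    rw [hconst, one_mul]
    refine Real.sqrt_le_sqrt ((hXq j).trans ?_)
    simpa using mul_le_of_le_one_left (hX0 j) hq1.le
  · exact Real.sqrt_zero ▸ hXlim.sqrt
  · exact Real.sqrt_zero ▸ hSlim.sqrt
  · exact Real.sqrt_zero ▸ hPlim.sqrt
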